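/- For $n\ge 1$ let $C_n\subset S_n$ be the cyclic group generated by an $n$-cycle $c$, and for an integer $r$ let $\exp(\frac{2\pi i}{n}r){\uparrow}_{C_n}^{S_n}$ be the complex representation of $S_n$ induced from the one-dimensional representation of $C_n$ in which $c$ acts as multiplication by $\exp(2\pi i r/n)$. Let $\mathrm{ch}$ be the Frobenius characteristic, $\mathrm{ch}(V)=\frac1{n!}\sum_{\sigma\in S_n}\mathrm{tr}_V(\sigma)\,p_{\lambda(\sigma)}$, where $p_\lambda$ is the power-sum symmetric function and $\lambda(\sigma)$ is the cycle type of $\sigma$. Put * $Lie_n=\mathrm{ch}\big(\exp(\frac{2\pi i}{n}){\uparrow}_{C_n}^{S_n}\big)$; * $Conj_n=\mathrm{ch}$ of the permutation representation of $S_n$ given by its conjugation action on the class of $n$-cycles; * $Lie_n^{(q)}=\mathrm{ch}\big(\exp(\frac{2\pi i}{n}q^{k}){\uparrow}_{C_n}^{S_n}\big)$ for a prime $q$, where $q^k$ is the highest power of $q$ dividing $n$; and $Lie=\sum_{n\ge1}Lie_n$, $Conj=\sum_{n\ge1}Conj_n$, $Lie^{(q)}=\sum_{n\ge1}Lie^{(q)}_n$,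 as formal sums of symmetric functions. Write $p_k[F]=F[p_k]=F(x_1^k,x_2^k,\ldots)$ for plethysm with the power sum $p_k$, and $\mu$ for the number-theoretic Möbius function. A (formal sum of) symmetric function(s) is Schur-positive if each homogeneous component is a linear combination with nonnegative integer coefficients of Schur functions, i.e. of Frobenius characteristics of irreducible complex representations of the symmetric group. **Theorem.** 1. $Conj=\sum_{k\ge1}p_k[Lie]$, and hence the sum on the right is Schur-positive. Equivalently, $Lie=\sum_{k\ge1}\mu(k)\,p_k[Conj]$. 2. $Conj=\sum_{k\ge1}p_{2k-1}[Lie^{(2)}]$, and hence the sum on the right is Schur-positive. Equivalently, $Lie^{(2)}=\sum_{k\ge1}\mu(2k-1)\,p_{2k-1}[Conj]$. 3. For every prime $q$, $Conj=\sum_{n\ge1,\ q\nmid n}p_n[Lie^{(q)}]$, and hence the sum on the right is Schur-positive. 4. For every integer $q\ge2$, $Conj=\sum_{n\ge1,\ q\nmid n}p_n\big[\sum_{k\ge0}Lie[p_{q^k}]\big]$. -/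

import Mathlib

noncomputable section

namespace SymPleth

open MvPowerSeries

/-- The ambient ring of formal power series over `ℂ` in the variables `x₀, x₁, x₂, …`.  It contains
the completion `∏ₙ Λⁿ` of the ring of symmetric functions. -/
abbrev Series : Type := MvPowerSeries ℕ ℂ

/-- The power sum `p_k = ∑ᵢ xᵢ ^ k`, for `k ≥ 1`. -/
def powerSum (k : ℕ) : Series := by
  classical exact fun d => if ∃ i : ℕ, d = Finsupp.single i k then 1 else 0

/-- `F` is the sum of the family `f` of formal power series: every monomial occurs in only finitely
many of the `f i`, and its coefficient in `F` is the sum of its coefficients in the `f i`. -/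
def HasFormalSum {ι : Type} (f : ι → Series) (F : Series) : Prop :=
  ∀ d : ℕ →₀ ℕ, {i | coeff d (f i) ≠ 0}.Finite ∧ coeff d F = ∑ᶠ i, coeff d (f i)

/-- The formal sum of a family; it is meaningful when `HasFormalSum f (formalSum f)`. -/
def formalSum {ι : Type} (f : ι → Series) : Series := fun d => ∑ᶠ i, coeff d (f i)

/-- The plethysm `p_k[F] = F[p_k] = F(x₀ ^ k, x₁ ^ k, …)` for `k ≥ 1`. -/
def powerPleth (k : ℕ+) (F : Series) : Series := expand (k : ℕ) k.ne_zero F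

/-- The Frobenius characteristic of a complex representation `ρ` of the group of permutations of a
set of `n` elements: `ch ρ = (1 / n!) ∑_σ tr (ρ σ) p_{λ(σ)}`, where `λ(σ)` is the cycle type of `σ`,
with fixed points as parts equal to 1, and `p_λ` is the product of the `p_{λᵢ}`. -/
def frobChar {α : Type} [Fintype α] [DecidableEq α] {V : Type} [AddCommGroup V] [Module ℂ V]
    (ρ : Representation ℂ (Equiv.Perm α) V) : Series :=
  (((Fintype.card α).factorial : ℂ)⁻¹) • ∑ σ : Equiv.Perm α,
    LinearMap.trace ℂ V (ρ σ) • ((Equiv.Perm.partition σ).parts.map powerSum).prod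

/-- The Schur functions of degree `n`: the Frobenius characteristics of the irreducible complex
representations of `S_n`. -/
def schurFunctions (n : ℕ) : Set Series :=
  {s | ∃ (V : Type) (_ : AddCommGroup V) (_ : Module ℂ V) (_ : FiniteDimensional ℂ V)
    (ρ : Representation ℂ (Equiv.Perm (Fin n)) V), ρ.IsIrreducible ∧ s = frobChar ρ}

/-- `F` is Schur-positive: for every `n`, its component of degree `n` is a (finite) linear
combination of Schur functions of degree `n` with nonnegative integer coefficients. -/
def SchurPositive (F : Series) : Prop :=
  ∀ n : ℕ, homogeneousComponent n F ∈ AddSubmonoid.closure (schurFunctions n)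

/-- The `n`-cycles among the permutations of a set of `n` elements (a single cycle through all the
points; for `n = 1` this is the identity). -/
def FullCycle (α : Type) : Type := {τ : Equiv.Perm α // τ.IsCycleOn Set.univ}

/-- The conjugacy action of the symmetric group on the class of `n`-cycles. -/
instance (α : Type) : MulAction (Equiv.Perm α) (FullCycle α) where
  smul σ τ := ⟨σ * τ.1 * σ⁻¹, by simpa using τ.2.conj (g := σ)⟩
  one_smul τ := Subtype.ext (by change 1 * τ.1 * 1⁻¹ = τ.1; simp)
  mul_smul σ π τ := Subtype.ext (by
    change (σ * π) * τ.1 * (σ * π)⁻¹ = σ * (π * τ.1 * π⁻¹) * σ⁻¹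
    simp [mul_assoc])

/-- `Conj_n`: the (Frobenius characteristic of the) permutation representation of `S_n` afforded by
the conjugacy action on the class of `n`-cycles. -/
def conjPart (n : ℕ+) : Series :=
  frobChar (Representation.ofMulAction ℂ (Equiv.Perm (Fin n)) (FullCycle (Fin n)))

/-- The cyclic group `C_n`, as the group of translations of `ℤ/n`: the homomorphism sends the
generator `1` to the `n`-cycle `x ↦ x + 1`. -/
def cyclicHom (n : ℕ+) : Multiplicative (ZMod n) →* Equiv.Perm (ZMod n) where
  toFun a := Equiv.addLeft a.toAdd
  map_one' := by ext x; simp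
  map_mul' a b := by ext x; simp

/-- The one-dimensional representation `exp (2πi r / n)` of `C_n`: the generator acts on `ℂ` as
multiplication by `exp (2πi r / n)`, and the element `a` as multiplication by
`exp (2πi r a / n)`. -/
def cyclicChar (n : ℕ+) (r : ℕ) : Representation ℂ (Multiplicative (ZMod n)) ℂ where
  toFun a := (ZMod.stdAddChar ((r : ZMod n) * a.toAdd)) • LinearMap.id
  map_one' := by ext; simp
  map_mul' a b := by ext; simp [mul_add, AddChar.map_add_eq_mul, mul_comm]

/-- `ℓ_n^{(r)}`: the Frobenius characteristic of the representation of `S_n` (the permutations of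
`ℤ/n`) induced from the representation `exp (2πi r / n)` of `C_n`. -/
def foulkes (n : ℕ+) (r : ℕ) : Series :=
  frobChar (Representation.ind (cyclicHom n) (cyclicChar n r))

/-- `Lie_n = ch (exp (2πi / n) ↑ S_n)`. -/
def liePart (n : ℕ+) : Series := foulkes n 1

/-- `Lie_n^{(q)} = ch (exp (2πi q^k / n) ↑ S_n)`, where `q^k` is the highest power of the prime `q`
dividing `n`. -/
def lieVariantPart (q : ℕ) (n : ℕ+) : Series := foulkes n (q ^ padicValNat q n)

/-- `Conj = ∑_{n ≥ 1} Conj_n`. -/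
def Conj : Series := formalSum conjPart

/-- `Lie = ∑_{n ≥ 1} Lie_n`. -/
def Lie : Series := formalSum liePart

/-- `Lie^{(q)} = ∑_{n ≥ 1} Lie_n^{(q)}`. -/
def LieVariant (q : ℕ) : Series := formalSum (lieVariantPart q)

end SymPleth

end

noncomputable section

namespace SymPleth

open MvPowerSeries ArithmeticFunction

open scoped ArithmeticFunction.Moebius ArithmeticFunction.zeta MonoidAlgebra

/-! Everything reduces to Dirichlet convolution. Call `necklaceSeries f` the series with degree-n
part (1/n) ∑_{e ∣ n} f(e) p_e^{n/e}. Since p_k[p_e] = p_{ke}, applying p_k replaces f by its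
convolution with the function that is k at k and 0 elsewhere. So ∑ g(k) p_k[·] convolves f with k ↦
k g(k) (`hasFormalSum_powerPleth_necklaceSeries`).

The formula for induced characters, applied to the translations of ℤ/n, gives `foulkes n r` the
Ramanujan sums as weights. Their Möbius inversion (`ramanujanSum_eq`) is F * μ with F(d) = d if d ∣
r, and 0 otherwise. Hence Lie has F = 1 (the convolution unit), Lie^{(q)} has F = id on powers of q,
and Conj, which is induced from the trivial character (r = 0), has F = id.

What remains is arithmetic: id on integers prime to q, convolved with id on powers of q, is id
(`nondivisibleId_mul_powersId`), and inserting μ gives the inverses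
(`nondivisibleMoebiusId_mul_nondivisibleId`). Schur-positivity holds because each sum is Conj, the
characteristic of genuine representations, which Maschke's theorem decomposes. -/

lemma coeff_powerSum (k : ℕ) (d : ℕ →₀ ℕ) [Decidable (∃ i : ℕ, d = Finsupp.single i k)] :
    coeff d (powerSum k) = if ∃ i : ℕ, d = Finsupp.single i k then 1 else 0 := by
  rw [coeff_apply, powerSum]
  congr

lemma eq_smul_of_forall_dvd {k : ℕ} {m : ℕ →₀ ℕ} (h : ∀ i, k ∣ m i) : ∃ m', m = k • m' := by
  choose g hg using h
  refine ⟨m.mapRange (· / k) (by simp), ?_⟩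
  ext i
  simp [Nat.mul_div_cancel' (⟨_, hg i⟩ : k ∣ m i)]

lemma expand_powerSum (k : ℕ) (hk : k ≠ 0) (d : ℕ) :
    expand k hk (powerSum d) = powerSum (k * d) := by
  classical
  ext m
  by_cases h : ∀ i, k ∣ m i
  · obtain ⟨m, rfl⟩ := eq_smul_of_forall_dvd h
    rw [coeff_expand_smul, coeff_powerSum, coeff_powerSum]
    congr! 2
    ext i
    rw [← smul_eq_mul, ← Finsupp.smul_single, nsmul_right_inj hk]
  · obtain ⟨i, hi⟩ := not_forall.1 h
    rw [coeff_expand_of_not_dvd k hk _ hi, coeff_powerSum, if_neg]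
    rintro ⟨j, rfl⟩
    apply hi
    rw [Finsupp.single_apply]
    split_ifs <;> simp

lemma coeff_powerSum_pow_eq_zero (k m : ℕ) (d : ℕ →₀ ℕ) (h : d.degree ≠ k * m) :
    coeff d (powerSum k ^ m) = 0 := by
  classical
  induction m generalizing d with
  | zero =>
    rw [pow_zero, coeff_one, if_neg]
    rintro rfl
    simp at h
  | succ m ih =>
    rw [pow_succ, coeff_mul]
    refine Finset.sum_eq_zero fun x hx => ?_
    rw [Finset.HasAntidiagonal.mem_antidiagonal] at hx
    by_cases h1 : x.1.degree = k * m
    · rw [coeff_powerSum k x.2, if_neg, mul_zero]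
      rintro ⟨i, hi⟩
      apply h
      rw [← hx, map_add, h1, hi, Finsupp.degree_single]
      ring
    · rw [ih _ h1, zero_mul]

/-! ### Necklace series, and plethysm as Dirichlet convolution -/

/-- The symmetric function `(1 / n) ∑_{e ∣ n} f e p_e ^ (n / e)`. -/
def necklacePart (f : ArithmeticFunction ℂ) (n : ℕ) : Series :=
  (n : ℂ)⁻¹ • ∑ e ∈ n.divisors, f e • powerSum e ^ (n / e)

/-- The formal sum of the `necklacePart f n` over all `n`. -/
def necklaceSeries (f : ArithmeticFunction ℂ) : Series :=
  fun d => coeff d (necklacePart f d.degree)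

lemma coeff_necklacePart (f : ArithmeticFunction ℂ) (n : ℕ) (d : ℕ →₀ ℕ) :
    coeff d (necklacePart f n) =
      (n : ℂ)⁻¹ * ∑ e ∈ n.divisors, f e * coeff d (powerSum e ^ (n / e)) := by
  simp [necklacePart, map_sum]

lemma coeff_necklaceSeries (f : ArithmeticFunction ℂ) (d : ℕ →₀ ℕ) :
    coeff d (necklaceSeries f) = coeff d (necklacePart f d.degree) := rfl

lemma coeff_necklacePart_eq_zero (f : ArithmeticFunction ℂ) {n : ℕ} {d : ℕ →₀ ℕ}
    (h : d.degree ≠ n) : coeff d (necklacePart f n) = 0 := by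
  rw [coeff_necklacePart, Finset.sum_eq_zero, mul_zero]
  intro e he
  rw [coeff_powerSum_pow_eq_zero, mul_zero]
  rwa [Nat.mul_div_cancel' (Nat.dvd_of_mem_divisors he)]

lemma homogeneousComponent_necklaceSeries (f : ArithmeticFunction ℂ) (n : ℕ) :
    homogeneousComponent n (necklaceSeries f) = necklacePart f n := by
  ext d
  rw [coeff_homogeneousComponent, coeff_necklaceSeries]
  split_ifs with h
  · rw [h]
  · exact (coeff_necklacePart_eq_zero f h).symm

lemma hasFormalSum_necklacePart (f : ArithmeticFunction ℂ) :
    HasFormalSum (fun n : ℕ+ => necklacePart f n) (necklaceSeries f) := by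
  intro d
  have key : ∀ n : ℕ+, coeff d (necklacePart f n) ≠ 0 → d.degree = n := fun n hn => by
    by_contra h
    exact hn (coeff_necklacePart_eq_zero f h)
  refine ⟨Set.Subsingleton.finite fun a ha b hb =>
    PNat.coe_injective ((key a ha).symm.trans (key b hb)), ?_⟩
  rw [coeff_necklaceSeries]
  -- Degree 0 has no index in `ℕ+`; this is consistent because `necklacePart f 0` is 0.
  by_cases h0 : d.degree = 0
  · rw [finsum_eq_zero_of_forall_eq_zero]
    · rw [h0, coeff_necklacePart]
      simp
    · intro n
      by_contra h
      exact n.ne_zero ((key n h).symm.trans h0)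
  · rw [finsum_eq_single _ (Nat.toPNat d.degree (Nat.pos_of_ne_zero h0))]
    · rfl
    · intro n hn
      by_contra h
      exact hn (PNat.coe_injective (key n h).symm)

lemma HasFormalSum.formalSum_eq {ι : Type} {f : ι → Series} {F : Series} (h : HasFormalSum f F) :
    formalSum f = F := by
  ext d
  exact (h d).2.symm

/-- Plethysm turns p_e^{n/e} / n into k p_{ke}^{n/e} / (kn): the degree becomes kn, and
renormalizing costs the factor k. -/
lemma coeff_powerPleth_necklaceSeries (f : ArithmeticFunction ℂ) (k : ℕ+) (d : ℕ →₀ ℕ) :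
    coeff d (powerPleth k (necklaceSeries f)) =
      (d.degree : ℂ)⁻¹ * ∑ e ∈ d.degree.divisors,
        (if (k : ℕ) ∣ e then k * f (e / k) else 0) *
          coeff d (powerSum e ^ (d.degree / e)) := by
  rw [powerPleth]
  have hk : (k : ℕ) ≠ 0 := k.ne_zero
  by_cases h : ∀ i, (k : ℕ) ∣ d i
  · obtain ⟨d, rfl⟩ := eq_smul_of_forall_dvd h
    rw [coeff_expand_smul, coeff_necklaceSeries, coeff_necklacePart]
    have hdeg : ((k : ℕ) • d).degree = k * d.degree := by
      rw [map_nsmul, smul_eq_mul]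
    rw [hdeg]
    simp_rw [ite_mul, zero_mul]
    rw [← Finset.sum_filter]
    have : (d.degree.divisors).image (fun e => (k : ℕ) * e) =
        ((k : ℕ) * d.degree).divisors.filter (fun e => (k : ℕ) ∣ e) := by
      ext e
      simp only [Finset.mem_image, Nat.mem_divisors, Finset.mem_filter]
      constructor
      · rintro ⟨a, ⟨ha, h0⟩, rfl⟩
        exact ⟨⟨mul_dvd_mul_left _ ha, mul_ne_zero hk h0⟩, dvd_mul_right _ _⟩
      · rintro ⟨⟨h1, h2⟩, a, rfl⟩
        exact ⟨a, ⟨(Nat.mul_dvd_mul_iff_left k.pos).1 h1, right_ne_zero_of_mul h2⟩, rfl⟩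
    rw [← this, Finset.sum_image fun a _ b _ hab => Nat.eq_of_mul_eq_mul_left k.pos hab,
      Finset.mul_sum, Finset.mul_sum]
    refine Finset.sum_congr rfl fun e he => ?_
    rw [Nat.mul_div_cancel_left _ k.pos, Nat.mul_div_mul_left _ _ k.pos,
      ← expand_powerSum k hk, ← map_pow, coeff_expand_smul]
    push_cast
    have : (k : ℂ) ≠ 0 := by exact_mod_cast hk
    field_simp
  -- Here both sides vanish: for k ∣ e, p_e is itself a series in the k-th powers of the variables.
  · obtain ⟨i, hi⟩ := not_forall.1 h
    rw [coeff_expand_of_not_dvd _ _ _ hi, Finset.sum_eq_zero, mul_zero]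
    intro e he
    split_ifs with hke
    · obtain ⟨e, rfl⟩ := hke
      rw [← expand_powerSum k hk, ← map_pow, coeff_expand_of_not_dvd _ _ _ hi, mul_zero]
    · rw [zero_mul]

lemma hasFormalSum_powerPleth_necklaceSeries {ι : Type} (s : ι → ℕ+) (hs : Function.Injective s)
    (g : ι → ℂ) (f h : ArithmeticFunction ℂ) (hg : ∀ i, h (s i) = g i * (s i : ℕ))
    (h0 : ∀ k : ℕ, k ∉ Set.range (fun i => (s i : ℕ)) → h k = 0) :
    HasFormalSum (fun i => g i • powerPleth (s i) (necklaceSeries f))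
      (necklaceSeries (h * f)) := by
  intro d
  set N := d.degree with hN
  -- `T` extends the terms from the index type to all naturals; only divisors of the degree
  -- contribute, which gives finiteness and allows the sums to be exchanged.
  set T : ℕ → ℂ := fun k => (N : ℂ)⁻¹ * ∑ e ∈ N.divisors,
    (if k ∣ e then h k * f (e / k) else 0) * coeff d (powerSum e ^ (N / e)) with hT
  have hterm : ∀ i, coeff d (g i • powerPleth (s i) (necklaceSeries f)) = T (s i) := by
    intro i
    rw [coeff_smul, coeff_powerPleth_necklaceSeries, hT, mul_left_comm, Finset.mul_sum]
    congr 1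
    refine Finset.sum_congr rfl fun e _ => ?_
    split_ifs
    · rw [hg]; ring
    · ring
  have hTz : ∀ k, k ∉ N.divisors → T k = 0 := by
    intro k hk
    rw [hT]
    refine mul_eq_zero_of_right _ (Finset.sum_eq_zero fun e he => ?_)
    rw [if_neg, zero_mul]
    intro hke
    rw [Nat.mem_divisors] at he
    exact hk (Nat.mem_divisors.2 ⟨hke.trans he.1, he.2⟩)
  have hinj : Function.Injective (fun i => (s i : ℕ)) := PNat.coe_injective.comp hs
  have hsub : Function.support (fun i => T (s i)) ⊆
      (N.divisors.preimage (fun i => (s i : ℕ)) hinj.injOn : Set ι) := by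
    intro i hi
    rw [Finset.coe_preimage]
    by_contra hc
    exact hi (hTz _ hc)
  simp_rw [hterm]
  refine ⟨(Finset.finite_toSet _).subset hsub, ?_⟩
  rw [finsum_eq_sum_of_support_subset _ hsub,
    Finset.sum_preimage (fun i => (s i : ℕ)) N.divisors hinj.injOn T, coeff_necklaceSeries,
    coeff_necklacePart, hT, ← Finset.mul_sum, Finset.sum_comm]
  · congr 1
    refine Finset.sum_congr rfl fun e he => ?_
    rw [← Finset.sum_mul, ArithmeticFunction.mul_apply,
      Nat.sum_divisorsAntidiagonal (fun x y => h x * f y), ← Finset.sum_filter]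
    congr 2
    rw [Nat.mem_divisors] at he
    ext k
    simp only [Nat.mem_divisors, Finset.mem_filter]
    exact ⟨fun hk => ⟨⟨hk.1.trans he.1, he.2⟩, hk.1⟩,
      fun hk => ⟨hk.2, ne_zero_of_dvd_ne_zero he.2 he.1⟩⟩
  · intro k _ hk
    simp only [hT, h0 k hk]
    simp

/-! ### Convolution identities -/

/-- The identity, restricted to the integers that are not divisible by `q`. -/
def nondivisibleId (q : ℕ) : ArithmeticFunction ℂ :=
  ⟨fun n => if q ∣ n then 0 else n, by simp⟩

/-- The function `n ↦ μ n * n`, restricted to the integers that are not divisible by `q`. -/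
def nondivisibleMoebiusId (q : ℕ) : ArithmeticFunction ℂ :=
  ⟨fun n => if q ∣ n then 0 else μ n * n, by simp⟩

open Classical in
/-- The identity, restricted to the powers of `q`. -/
def powersId (q : ℕ) : ArithmeticFunction ℂ :=
  ⟨fun n => if ∃ k, n = q ^ k then n else 0, by simp⟩

open Classical in
lemma powersId_apply (q n : ℕ) : powersId q n = if ∃ k, n = q ^ k then (n : ℂ) else 0 := rfl

lemma nondivisibleId_apply (q n : ℕ) :
    nondivisibleId q n = if q ∣ n then (0 : ℂ) else n := rfl

lemma nondivisibleMoebiusId_apply (q n : ℕ) :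
    nondivisibleMoebiusId q n = if q ∣ n then (0 : ℂ) else μ n * n := rfl

lemma pow_mul_right_unique {q : ℕ} (hq : 2 ≤ q) {a b x y : ℕ} (hx : ¬ q ∣ x) (hy : ¬ q ∣ y)
    (h : q ^ a * x = q ^ b * y) : x = y := by
  wlog hab : a ≤ b generalizing a b x y
  · exact (this hy hx h.symm (Nat.le_of_not_le hab)).symm
  obtain ⟨c, rfl⟩ := Nat.exists_eq_add_of_le hab
  rw [pow_add, mul_assoc] at h
  have h' := Nat.eq_of_mul_eq_mul_left (pow_pos (by omega) a) h
  cases c with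
  | zero => simpa using h'
  | succ c => exact absurd ⟨q ^ c * y, by rw [h']; ring⟩ hx

/-- Every n ≥ 1 is uniquely m q^k with q ∤ m, so one term of the convolution survives; primality of
q plays no role. As 0 divides only 0, `nondivisibleId 0` is the full identity. -/
lemma nondivisibleId_mul_powersId {q : ℕ} (hq : 2 ≤ q) :
    nondivisibleId q * powersId q = nondivisibleId 0 := by
  classical
  ext n
  rcases eq_or_ne n 0 with rfl | hn
  · simp
  obtain ⟨k, m, hm, rfl⟩ := Nat.exists_eq_pow_mul_and_not_dvd hn q (by omega)
  rw [ArithmeticFunction.mul_apply, Finset.sum_eq_single (m, q ^ k)]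
  · simp only [nondivisibleId_apply, powersId_apply]
    rw [if_neg hm, if_pos ⟨k, rfl⟩, if_neg (by simpa using hn)]
    push_cast
    ring
  · rintro ⟨x, y⟩ hxy hne
    rw [Nat.mem_divisorsAntidiagonal] at hxy
    simp only [nondivisibleId_apply, powersId_apply]
    by_cases hx : q ∣ x
    · simp [hx]
    by_cases hy : ∃ k, y = q ^ k
    · obtain ⟨j, rfl⟩ := hy
      exfalso
      obtain rfl := pow_mul_right_unique hq hx hm ((mul_comm _ _).trans hxy.1)
      have hx0 : x ≠ 0 := by rintro rfl; simp at hx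
      apply hne
      exact congrArg (Prod.mk x)
        (Nat.eq_of_mul_eq_mul_left (Nat.pos_of_ne_zero hx0) (hxy.1.trans (mul_comm _ _)))
    · simp [hy]
  · intro h
    refine absurd (Nat.mem_divisorsAntidiagonal.2 ⟨mul_comm _ _, hn⟩) h

/-- The function n·[q ∤ n] is completely multiplicative under `hq`, so it factors out of the
convolution and leaves μ * ζ = 1. Both primes and q = 0 qualify. -/
lemma nondivisibleMoebiusId_mul_nondivisibleId {q : ℕ} (h1 : q ≠ 1)
    (hq : ∀ x y, q ∣ x * y → q ∣ x ∨ q ∣ y) :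
    nondivisibleMoebiusId q * nondivisibleId q = 1 := by
  ext n
  rw [ArithmeticFunction.mul_apply]
  have key : ∑ x ∈ n.divisorsAntidiagonal, nondivisibleMoebiusId q x.1 * nondivisibleId q x.2 =
      (if q ∣ n then 0 else n) * ((μ : ArithmeticFunction ℂ) * ζ) n := by
    rw [ArithmeticFunction.mul_apply, Finset.mul_sum]
    refine Finset.sum_congr rfl fun x hx => ?_
    rw [Nat.mem_divisorsAntidiagonal] at hx
    have hx2 : x.2 ≠ 0 := right_ne_zero_of_mul (hx.1.trans_ne hx.2)
    rw [← hx.1, nondivisibleMoebiusId_apply, nondivisibleId_apply]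
    by_cases ha : q ∣ x.1
    · simp [ha, dvd_mul_of_dvd_left ha]
    by_cases hb : q ∣ x.2
    · simp [hb, dvd_mul_of_dvd_right hb]
    · rw [if_neg ha, if_neg hb, if_neg fun h => (hq _ _ h).elim ha hb]
      simp [hx2]
      ring
  rw [key, coe_moebius_mul_coe_zeta, one_apply]
  split_ifs <;> simp_all

/-! ### The families of plethysms in the theorem -/

lemma hasFormalSum_powerPleth_coprime (q : ℕ) (f : ArithmeticFunction ℂ) :
    HasFormalSum (fun n : {n : ℕ+ // ¬ q ∣ (n : ℕ)} => powerPleth n (necklaceSeries f))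
      (necklaceSeries (nondivisibleId q * f)) := by
  have := hasFormalSum_powerPleth_necklaceSeries
    (fun n : {n : ℕ+ // ¬ q ∣ (n : ℕ)} => (n : ℕ+)) Subtype.val_injective (fun _ => 1) f
    (nondivisibleId q) ?_ ?_
  · simpa only [one_smul] using this
  · intro n
    simp [nondivisibleId_apply, n.2]
  · intro k hk
    rw [nondivisibleId_apply]
    split_ifs with h
    · rfl
    · have h0 : k ≠ 0 := by rintro rfl; simp at h
      exact absurd ⟨⟨⟨k, Nat.pos_of_ne_zero h0⟩, h⟩, rfl⟩ hk

lemma hasFormalSum_powerPleth_powers {q : ℕ+} (hq : 2 ≤ q) (f : ArithmeticFunction ℂ) :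
    HasFormalSum (fun k : ℕ => powerPleth (q ^ k) (necklaceSeries f))
      (necklaceSeries (powersId q * f)) := by
  have := hasFormalSum_powerPleth_necklaceSeries (fun k : ℕ => q ^ k) ?_ (fun _ => 1) f
    (powersId q) ?_ ?_
  · simpa only [one_smul] using this
  · intro a b hab
    have hab' : (q : ℕ) ^ a = (q : ℕ) ^ b := by simpa using congrArg PNat.val hab
    exact Nat.pow_right_injective (by exact_mod_cast hq) hab'
  · intro k
    rw [powersId_apply, if_pos ⟨k, PNat.pow_coe _ _⟩, one_mul]
  · intro k hk
    rw [powersId_apply, if_neg]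
    rintro ⟨j, rfl⟩
    exact hk ⟨j, PNat.pow_coe _ _⟩

lemma hasFormalSum_powerPleth (f : ArithmeticFunction ℂ) :
    HasFormalSum (fun k : ℕ+ => powerPleth k (necklaceSeries f))
      (necklaceSeries (nondivisibleId 0 * f)) := by
  have := hasFormalSum_powerPleth_necklaceSeries (fun k : ℕ+ => k) Function.injective_id
    (fun _ => 1) f (nondivisibleId 0) ?_ ?_
  · simpa only [one_smul] using this
  · intro n
    simp [nondivisibleId_apply]
  · intro k hk
    rw [nondivisibleId_apply, if_pos]
    rw [zero_dvd_iff]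
    by_contra h
    exact hk ⟨⟨k, Nat.pos_of_ne_zero h⟩, rfl⟩

lemma hasFormalSum_moebius_smul_powerPleth (f : ArithmeticFunction ℂ) :
    HasFormalSum (fun k : ℕ+ => μ (k : ℕ) • powerPleth k (necklaceSeries f))
      (necklaceSeries (nondivisibleMoebiusId 0 * f)) := by
  have := hasFormalSum_powerPleth_necklaceSeries (fun k : ℕ+ => k) Function.injective_id
    (fun k => μ (k : ℕ)) f (nondivisibleMoebiusId 0) ?_ ?_
  · simpa only [Int.cast_smul_eq_zsmul] using this
  · intro n
    simp [nondivisibleMoebiusId_apply]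
  · intro k hk
    rw [nondivisibleMoebiusId_apply, if_pos]
    rw [zero_dvd_iff]
    by_contra h
    exact hk ⟨⟨k, Nat.pos_of_ne_zero h⟩, rfl⟩

/-- Subtraction in `ℕ+` is cut off at 1; it is genuine here because 1 < 2k. -/
lemma coe_two_mul_sub_one (k : ℕ+) : ((2 * k - 1 : ℕ+) : ℕ) = 2 * (k : ℕ) - 1 := by
  have h := k.pos
  rw [PNat.sub_coe, if_pos]
  · simp
  · rw [← PNat.coe_lt_coe]
    push_cast
    omega

lemma two_mul_sub_one_injective : Function.Injective fun k : ℕ+ => 2 * k - 1 := by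
  intro a b hab
  have := congrArg PNat.val hab
  simp only [] at this
  erw [coe_two_mul_sub_one, coe_two_mul_sub_one] at this
  apply PNat.coe_injective
  have ha := a.pos
  have hb := b.pos
  omega

lemma mem_range_two_mul_sub_one {k : ℕ} (hk : ¬ 2 ∣ k) :
    k ∈ Set.range fun i : ℕ+ => ((2 * i - 1 : ℕ+) : ℕ) := by
  refine ⟨⟨(k + 1) / 2, by omega⟩, (coe_two_mul_sub_one _).trans ?_⟩
  rw [PNat.mk_coe]
  omega

lemma not_two_dvd_two_mul_sub_one (k : ℕ+) : ¬ 2 ∣ 2 * (k : ℕ) - 1 := by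
  have := k.pos
  omega

lemma hasFormalSum_powerPleth_odd (f : ArithmeticFunction ℂ) :
    HasFormalSum (fun k : ℕ+ => powerPleth (2 * k - 1) (necklaceSeries f))
      (necklaceSeries (nondivisibleId 2 * f)) := by
  have := hasFormalSum_powerPleth_necklaceSeries _ two_mul_sub_one_injective
    (fun _ => 1) f (nondivisibleId 2) ?_ ?_
  · simpa only [one_smul] using this
  · intro k
    rw [coe_two_mul_sub_one, nondivisibleId_apply, if_neg (not_two_dvd_two_mul_sub_one k), one_mul]
  · intro k hk
    rw [nondivisibleId_apply, if_pos]
    by_contra h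
    exact hk (mem_range_two_mul_sub_one h)

lemma hasFormalSum_moebius_smul_powerPleth_odd (f : ArithmeticFunction ℂ) :
    HasFormalSum
      (fun k : ℕ+ => μ (2 * (k : ℕ) - 1) • powerPleth (2 * k - 1) (necklaceSeries f))
      (necklaceSeries (nondivisibleMoebiusId 2 * f)) := by
  have := hasFormalSum_powerPleth_necklaceSeries _ two_mul_sub_one_injective
    (fun k => μ (2 * (k : ℕ) - 1)) f (nondivisibleMoebiusId 2) ?_ ?_
  · simpa only [Int.cast_smul_eq_zsmul] using this
  · intro k
    rw [coe_two_mul_sub_one, nondivisibleMoebiusId_apply,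
      if_neg (not_two_dvd_two_mul_sub_one k)]
  · intro k hk
    rw [nondivisibleMoebiusId_apply, if_pos]
    by_contra h
    exact hk (mem_range_two_mul_sub_one h)

/-! ### Traces of induced representations -/

section Trace

/-- The trace of the map induced on coinvariants is the average of the traces. -/
lemma trace_coinvariants_map {G V : Type} [Group G] [Fintype G] [AddCommGroup V] [Module ℂ V]
    [FiniteDimensional ℂ V] (ρ : Representation ℂ G V) (T : Representation.IntertwiningMap ρ ρ) :
    LinearMap.trace ℂ _ (Representation.Coinvariants.map ρ ρ T) =
      (Fintype.card G : ℂ)⁻¹ * ∑ g : G, LinearMap.trace ℂ V (ρ g ∘ₗ T.toLinearMap) := by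
  -- The averaging operator factors through the coinvariants as a section `s` of the quotient map;
  -- cyclicity of the trace then moves the computation to `V`.
  let A : V →ₗ[ℂ] V := (Fintype.card G : ℂ)⁻¹ • ∑ g : G, ρ g
  have hA : ∀ x : G, A ∘ₗ ρ x = A := fun x => by
    simp only [A, LinearMap.smul_comp]
    congr 1
    ext v
    simp only [LinearMap.comp_apply, LinearMap.sum_apply, ← Module.End.mul_apply, ← map_mul]
    exact Fintype.sum_equiv (Equiv.mulRight x) _ _ fun g => rfl
  let s : Representation.Coinvariants ρ →ₗ[ℂ] V := Representation.Coinvariants.lift ρ A hA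
  have hcard : (Fintype.card G : ℂ) ≠ 0 := by exact_mod_cast Fintype.card_ne_zero
  have h1 : Representation.Coinvariants.mk ρ ∘ₗ s = LinearMap.id := by
    refine Representation.Coinvariants.hom_ext ?_
    ext v
    simp only [s, LinearMap.comp_apply, Representation.Coinvariants.lift_mk, A,
      LinearMap.smul_apply, LinearMap.sum_apply, map_smul, map_sum,
      Representation.Coinvariants.mk_self_apply, Finset.sum_const, Finset.card_univ,
      LinearMap.id_apply]
    rw [← Nat.cast_smul_eq_nsmul ℂ, smul_smul, inv_mul_cancel₀ hcard, one_smul]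
  calc _ = LinearMap.trace ℂ _ ((Representation.Coinvariants.mk ρ ∘ₗ T.toLinearMap) ∘ₗ s) := by
        rw [← LinearMap.comp_id (Representation.Coinvariants.map ρ ρ T), ← h1,
          ← LinearMap.comp_assoc]
        rfl
    _ = LinearMap.trace ℂ V (s ∘ₗ (Representation.Coinvariants.mk ρ ∘ₗ T.toLinearMap)) :=
        LinearMap.trace_comp_comm' _ _
    _ = LinearMap.trace ℂ V (A ∘ₗ T.toLinearMap) := by
        rw [← LinearMap.comp_assoc, Representation.Coinvariants.lift_comp_mk]
    _ = _ := by
        have : (∑ g : G, ρ g) ∘ₗ T.toLinearMap = ∑ g : G, ρ g ∘ₗ T.toLinearMap := by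
          ext v
          simp [LinearMap.sum_apply]
        simp only [A, LinearMap.smul_comp, map_smul, smul_eq_mul, this, map_sum]

lemma trace_eq_card_fixed {H : Type} [Fintype H] [DecidableEq H] (f : H → H) (L : ℂ[H] →ₗ[ℂ] ℂ[H])
    (hL : ∀ x, L (MonoidAlgebra.single x 1) = MonoidAlgebra.single (f x) 1) :
    LinearMap.trace ℂ _ L = ∑ x : H, if f x = x then 1 else 0 := by
  let b : Module.Basis H ℂ ℂ[H] := .ofRepr (MonoidAlgebra.coeffLinearEquiv ℂ)
  have hb : ∀ x, b x = MonoidAlgebra.single x 1 := fun x => rfl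
  rw [LinearMap.trace_eq_matrix_trace ℂ b, Matrix.trace]
  refine Finset.sum_congr rfl fun x _ => ?_
  rw [Matrix.diag_apply, LinearMap.toMatrix_apply, hb, hL]
  change (MonoidAlgebra.single (f x) (1 : ℂ)).coeff x = _
  rw [MonoidAlgebra.coeff_single, Finsupp.single_apply]

instance {H : Type} [Finite H] : FiniteDimensional ℂ ℂ[H] :=
  Module.Finite.equiv (MonoidAlgebra.coeffLinearEquiv ℂ).symm

/-- The induced representation is the `G`-coinvariants of ℂ[H] ⊗ V, with h acting by right
multiplication by h⁻¹. Averaging over `G` factors the trace, and the ℂ[H] factor counts the x with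
φ(g) x h⁻¹ = x. -/
lemma trace_ind {G H V : Type} [Group G] [Fintype G] [Group H] [Fintype H] [DecidableEq H]
    [AddCommGroup V] [Module ℂ V] [FiniteDimensional ℂ V] (φ : G →* H)
    (ρ : Representation ℂ G V) (h : H) :
    LinearMap.trace ℂ _ (Representation.ind φ ρ h) =
      (Fintype.card G : ℂ)⁻¹ * ∑ g : G, LinearMap.trace ℂ V (ρ g) *
        ∑ x : H, if x⁻¹ * φ g * x = h then 1 else 0 := by
  rw [Representation.ind_apply, trace_coinvariants_map]
  congr 1
  refine Finset.sum_congr rfl fun g _ => ?_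
  rw [mul_comm]
  have : Representation.tprod ((Representation.leftRegular ℂ H).comp φ) ρ g ∘ₗ
      (MonoidAlgebra.mapDomainLinearMap ℂ ℂ fun x => x * h⁻¹).rTensor V =
      TensorProduct.map (Representation.leftRegular ℂ H (φ g) ∘ₗ
        MonoidAlgebra.mapDomainLinearMap ℂ ℂ fun x => x * h⁻¹) (ρ g) := by
    rw [LinearMap.rTensor, Representation.tprod_apply, ← TensorProduct.map_comp]
    rfl
  refine (congrArg (LinearMap.trace ℂ _) this).trans ?_
  rw [LinearMap.trace_tensorProduct', trace_eq_card_fixed (fun x => φ g * (x * h⁻¹))]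
  · congr 1
    refine Finset.sum_congr rfl fun x _ => ?_
    congr 1
    rw [← mul_assoc, mul_inv_eq_iff_eq_mul, mul_assoc, inv_mul_eq_iff_eq_mul]
  · intro x
    simp

end Trace

/-! ### Frobenius characteristics of induced representations -/

section Frobenius

variable {α : Type} [Fintype α] [DecidableEq α]

/-- The power sum symmetric function indexed by the cycle type of `σ`. -/
def cyclePowerSum (σ : Equiv.Perm α) : Series :=
  ((Equiv.Perm.partition σ).parts.map powerSum).prod

lemma cyclePowerSum_conj (σ τ : Equiv.Perm α) :
    cyclePowerSum (τ * σ * τ⁻¹) = cyclePowerSum σ := by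
  rw [cyclePowerSum, cyclePowerSum,
    Equiv.Perm.partition_eq_of_isConj.1 (isConj_iff.2 ⟨τ, rfl⟩ : IsConj σ (τ * σ * τ⁻¹))]

/-- Cycle power sums are class functions, so the sum over conjugators x only contributes a factor
n!, cancelling the normalization. -/
lemma frobChar_ind {G V : Type} [Group G] [Fintype G]
    [AddCommGroup V] [Module ℂ V] [FiniteDimensional ℂ V] (φ : G →* Equiv.Perm α)
    (ρ : Representation ℂ G V) :
    frobChar (Representation.ind φ ρ) =
      (Fintype.card G : ℂ)⁻¹ • ∑ g : G, LinearMap.trace ℂ V (ρ g) • cyclePowerSum (φ g) := by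
  have key : ∀ g : G, ∑ σ : Equiv.Perm α, (∑ x : Equiv.Perm α,
      if x⁻¹ * φ g * x = σ then (1 : ℂ) else 0) • cyclePowerSum σ =
      ((Fintype.card α).factorial : ℂ) • cyclePowerSum (φ g) := by
    intro g
    simp_rw [Finset.sum_smul]
    rw [Finset.sum_comm]
    simp_rw [ite_smul, one_smul, zero_smul, Finset.sum_ite_eq, Finset.mem_univ, if_true]
    have : ∀ x : Equiv.Perm α, cyclePowerSum (x⁻¹ * φ g * x) = cyclePowerSum (φ g) := fun x => by
      simpa using cyclePowerSum_conj (φ g) x⁻¹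
    simp_rw [this]
    rw [Finset.sum_const, Finset.card_univ, Fintype.card_perm, ← Nat.cast_smul_eq_nsmul ℂ]
  have hn : ((Fintype.card α).factorial : ℂ) ≠ 0 := by exact_mod_cast Nat.factorial_ne_zero _
  calc frobChar (Representation.ind φ ρ)
      = ((Fintype.card α).factorial : ℂ)⁻¹ • ∑ σ : Equiv.Perm α,
        LinearMap.trace ℂ _ (Representation.ind φ ρ σ) • cyclePowerSum σ := rfl
    _ = ((Fintype.card α).factorial : ℂ)⁻¹ • (Fintype.card G : ℂ)⁻¹ • ∑ g : G,
        LinearMap.trace ℂ V (ρ g) • ∑ σ : Equiv.Perm α, (∑ x : Equiv.Perm α,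
          if x⁻¹ * φ g * x = σ then (1 : ℂ) else 0) • cyclePowerSum σ := by
        simp_rw [trace_ind, mul_smul, Finset.sum_smul, ← Finset.smul_sum]
        rw [Finset.sum_comm]
        simp_rw [mul_smul, ← Finset.smul_sum, Finset.sum_smul]
    _ = _ := by
        simp_rw [key]
        simp_rw [smul_comm _ ((Fintype.card α).factorial : ℂ), ← Finset.smul_sum]
        rw [smul_comm _ ((Fintype.card α).factorial : ℂ), smul_smul, inv_mul_cancel₀ hn, one_smul]

lemma parts_partition_of_semiregular (σ : Equiv.Perm α) {m : ℕ} (hm : 0 < m)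
    (h : ∀ x k, (σ ^ k) x = x ↔ m ∣ k) :
    (Equiv.Perm.partition σ).parts = Multiset.replicate (Fintype.card α / m) m := by
  have hall : ∀ l ∈ (Equiv.Perm.partition σ).parts, l = m := by
    intro l hl
    rw [Equiv.Perm.parts_partition, Multiset.mem_add] at hl
    rcases hl with hl | hl
    · obtain ⟨c, τ, rfl, hd, hc, rfl⟩ := Equiv.Perm.mem_cycleType_iff.1 hl
      obtain ⟨x, hx⟩ := hc.nonempty_support
      rw [Equiv.Perm.mem_support] at hx
      -- The factor τ disjoint from c fixes x, so the period of x under σ is the length of c.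
      have key : ∀ k, c.support.card ∣ k ↔ m ∣ k := fun k => by
        rw [← h x k, hd.commute.mul_pow, Equiv.Perm.mul_apply,
          Equiv.Perm.pow_apply_eq_self_of_apply_eq_self ((hd x).resolve_left hx),
          ← hc.pow_eq_one_iff' hx, ← orderOf_dvd_iff_pow_eq_one, hc.orderOf]
      exact dvd_antisymm ((key m).2 dvd_rfl) ((key _).1 dvd_rfl)
    · obtain ⟨hc, rfl⟩ := Multiset.mem_replicate.1 hl
      have : ∃ x, x ∉ σ.support := by
        by_contra hx
        push Not at hx
        exact hc (by rw [Finset.eq_univ_iff_forall.2 hx, Finset.card_univ, Nat.sub_self])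
      obtain ⟨x, hx⟩ := this
      rw [Equiv.Perm.notMem_support] at hx
      exact (Nat.dvd_one.1 ((h x 1).1 (by simpa using hx))).symm
  rw [Multiset.eq_replicate_of_mem hall]
  congr 1
  have := (Equiv.Perm.partition σ).parts_sum
  rw [Multiset.eq_replicate_of_mem hall, Multiset.sum_replicate, smul_eq_mul] at this
  exact (Nat.div_eq_of_eq_mul_left hm this.symm).symm

end Frobenius

/-! ### Ramanujan sums and the cyclic characters -/

lemma addLeft_pow_apply {n : ℕ} (a x : ZMod n) (k : ℕ) :
    ((Equiv.addLeft a : Equiv.Perm (ZMod n)) ^ k) x = k • a + x := by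
  induction k with
  | zero => simp
  | succ k ih => rw [pow_succ', Equiv.Perm.mul_apply, ih, succ_nsmul']; simp [add_assoc]

lemma cyclePowerSum_addLeft (n : ℕ+) (a : ZMod n) :
    cyclePowerSum (Equiv.addLeft a : Equiv.Perm (ZMod n)) =
      powerSum (addOrderOf a) ^ ((n : ℕ) / addOrderOf a) := by
  rw [cyclePowerSum, parts_partition_of_semiregular _ (addOrderOf_pos a), ZMod.card,
    Multiset.map_replicate, Multiset.prod_replicate]
  intro x k
  rw [addLeft_pow_apply, addOrderOf_dvd_iff_nsmul_eq_zero, add_eq_right]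

/-- The Ramanujan sum: the sum of the `r`-th powers of the roots of unity `exp (2πi a / n)` with
`a` of order `d` in `ℤ/n`. -/
def ramanujanSum (n : ℕ+) (r d : ℕ) : ℂ :=
  ∑ a : ZMod n with addOrderOf a = d, ZMod.stdAddChar ((r : ZMod n) * a)

lemma foulkes_eq (n : ℕ+) (r : ℕ) :
    foulkes n r = ((n : ℕ) : ℂ)⁻¹ • ∑ a : ZMod n, (ZMod.stdAddChar ((r : ZMod n) * a)) •
      cyclePowerSum (Equiv.addLeft a : Equiv.Perm (ZMod n)) := by
  rw [foulkes, frobChar_ind, Fintype.card_multiplicative, ZMod.card]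
  congr 1
  refine Fintype.sum_equiv Multiplicative.toAdd _ _ fun a => ?_
  have : LinearMap.trace ℂ ℂ (cyclicChar n r a) = ZMod.stdAddChar ((r : ZMod n) * a.toAdd) := by
    change LinearMap.trace ℂ ℂ ((ZMod.stdAddChar ((r : ZMod n) * a.toAdd) : ℂ) • LinearMap.id) = _
    simp
  rw [this]
  rfl

lemma sum_smul_cyclePowerSum (n : ℕ+) (r : ℕ) (f : ArithmeticFunction ℂ)
    (hf : ∀ d ∈ (n : ℕ).divisors, ramanujanSum n r d = f d) :
    ((n : ℕ) : ℂ)⁻¹ • ∑ a : ZMod n, (ZMod.stdAddChar ((r : ZMod n) * a)) •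
      cyclePowerSum (Equiv.addLeft a : Equiv.Perm (ZMod n)) = necklacePart f n := by
  rw [necklacePart]
  congr 1
  rw [← Finset.sum_fiberwise_of_maps_to (t := (n : ℕ).divisors) (g := fun a : ZMod n => addOrderOf a)]
  · refine Finset.sum_congr rfl fun d hd => ?_
    rw [← hf d hd, ramanujanSum, Finset.sum_smul]
    refine Finset.sum_congr rfl fun a ha => ?_
    rw [cyclePowerSum_addLeft, (Finset.mem_filter.1 ha).2]
  · intro a _
    rw [Nat.mem_divisors]
    refine ⟨?_, n.ne_zero⟩
    simpa using addOrderOf_dvd_card (x := a)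

lemma foulkes_eq_necklacePart (n : ℕ+) (r : ℕ) (f : ArithmeticFunction ℂ)
    (hf : ∀ d ∈ (n : ℕ).divisors, ramanujanSum n r d = f d) :
    foulkes n r = necklacePart f n := by
  rw [foulkes_eq, sum_smul_cyclePowerSum n r f hf]

/-- The sum collects the d-torsion of ℤ/n, a cyclic group of order d, and orthogonality of
characters applies. -/
lemma sum_ramanujanSum (n : ℕ+) (r d : ℕ) (hd : d ∣ n) :
    ∑ e ∈ d.divisors, ramanujanSum n r e = if d ∣ r then (d : ℂ) else 0 := by
  have hn : (n : ℕ) ≠ 0 := n.ne_zero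
  obtain ⟨m, hm⟩ := hd
  have hd0 : d ≠ 0 := by rintro rfl; simp at hm
  have hm0 : m ≠ 0 := by rintro rfl; simp at hm
  have : NeZero d := ⟨hd0⟩
  have h1 : ∑ e ∈ d.divisors, ramanujanSum n r e =
      ∑ a : ZMod n with d • a = 0, ZMod.stdAddChar ((r : ZMod n) * a) := by
    rw [← Finset.sum_fiberwise_of_maps_to (t := d.divisors) (g := fun a : ZMod n => addOrderOf a)]
    · refine Finset.sum_congr rfl fun e he => ?_
      rw [ramanujanSum, Finset.filter_filter]
      refine Finset.sum_congr (Finset.filter_congr fun a _ => ?_) fun _ _ => rfl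
      refine ⟨fun h => ⟨?_, h⟩, fun h => h.2⟩
      rw [← addOrderOf_dvd_iff_nsmul_eq_zero, h]
      exact Nat.dvd_of_mem_divisors he
    · intro a ha
      rw [Nat.mem_divisors, addOrderOf_dvd_iff_nsmul_eq_zero]
      exact ⟨(Finset.mem_filter.1 ha).2, hd0⟩
  have h2 : ∑ a : ZMod n with d • a = 0, ZMod.stdAddChar ((r : ZMod n) * a) =
      ∑ j : ZMod d, ZMod.stdAddChar (j * (r : ZMod d)) := by
    symm
    -- With n = d m, the d-torsion consists of the multiples of m.
    refine Finset.sum_nbij (fun j : ZMod d => ((m * j.val : ℕ) : ZMod n)) ?_ ?_ ?_ ?_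
    · intro j _
      rw [Finset.mem_filter]
      refine ⟨Finset.mem_univ _, ?_⟩
      rw [nsmul_eq_mul, ← Nat.cast_mul, ZMod.natCast_eq_zero_iff, ← mul_assoc, hm]
      exact dvd_mul_right _ _
    · intro i _ j _ hij
      simp only [] at hij
      rw [ZMod.natCast_eq_natCast_iff, hm, mul_comm d m] at hij
      have := Nat.ModEq.mul_left_cancel' hm0 hij
      rwa [← ZMod.natCast_eq_natCast_iff, ZMod.natCast_zmod_val, ZMod.natCast_zmod_val] at this
    · intro a ha
      have ha' := (Finset.mem_filter.1 ha).2
      rw [← ZMod.natCast_zmod_val a, nsmul_eq_mul, ← Nat.cast_mul, ZMod.natCast_eq_zero_iff] at ha'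
      obtain ⟨t, ht⟩ := Nat.dvd_of_mul_dvd_mul_left (Nat.pos_of_ne_zero hd0)
        ((dvd_of_eq hm.symm).trans ha')
      have htd : t < d := by
        have := ZMod.val_lt a
        rw [ht] at this
        exact lt_of_mul_lt_mul_left (this.trans_eq (hm.trans (mul_comm d m))) (Nat.zero_le _)
      refine ⟨(t : ZMod d), Finset.mem_coe.2 (Finset.mem_univ _), ?_⟩
      simp only []
      rw [ZMod.val_natCast_of_lt htd, ← ht, ZMod.natCast_zmod_val]
    · intro j _
      have e1 : j * (r : ZMod d) = ((j.val * r : ℤ) : ZMod d) := by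
        push_cast
        simp
      have e2 : (r : ZMod n) * ((m * j.val : ℕ) : ZMod n) = ((r * (m * j.val) : ℤ) : ZMod n) := by
        push_cast
        rfl
      rw [e1, e2, ZMod.stdAddChar_coe, ZMod.stdAddChar_coe, hm]
      congr 1
      have : (d : ℂ) ≠ 0 := by exact_mod_cast hd0
      have : (m : ℂ) ≠ 0 := by exact_mod_cast hm0
      push_cast
      field_simp
  rw [h1, h2, AddChar.sum_mulShift _ (ZMod.isPrimitive_stdAddChar d), ZMod.card]
  simp only [ZMod.natCast_eq_zero_iff]
  push_cast
  rfl

/-- Möbius inversion on the divisors of n. As `f` is constrained only there, a single `f` can serve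
all n even when r varies with n. -/
lemma ramanujanSum_eq (n : ℕ+) (r : ℕ) (f : ArithmeticFunction ℂ)
    (hf : ∀ d ∈ (n : ℕ).divisors, f d = if d ∣ r then (d : ℂ) else 0) :
    ∀ d ∈ (n : ℕ).divisors, ramanujanSum n r d = (f * (μ : ArithmeticFunction ℂ)) d := by
  intro d hd
  rw [mul_comm, ArithmeticFunction.mul_apply]
  refine ((sum_eq_iff_sum_mul_moebius_eq_on (g := fun d => f d)
    {d | d ∈ (n : ℕ).divisors} ?_).1 ?_ d (Nat.pos_of_mem_divisors hd) hd).symm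
  · intro a b hab hb
    rw [Set.mem_ofPred_eq, Nat.mem_divisors] at hb ⊢
    exact ⟨hab.trans hb.1, hb.2⟩
  · intro e _ he
    rw [sum_ramanujanSum n r e (Nat.dvd_of_mem_divisors he), hf e he]

lemma liePart_eq (n : ℕ+) : liePart n = necklacePart (μ : ArithmeticFunction ℂ) n := by
  rw [liePart, ← one_mul (μ : ArithmeticFunction ℂ)]
  refine foulkes_eq_necklacePart n 1 _ (ramanujanSum_eq n 1 1 fun d _ => ?_)
  simp only [one_apply, Nat.dvd_one]
  split_ifs with h <;> simp [h]

/-- A divisor of n divides the q-part of n exactly when it is a power of q, a condition independent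
of n. -/
lemma lieVariantPart_eq {q : ℕ} (hq : q.Prime) (n : ℕ+) :
    lieVariantPart q n = necklacePart (powersId q * (μ : ArithmeticFunction ℂ)) n := by
  classical
  refine foulkes_eq_necklacePart n _ _ (ramanujanSum_eq n _ _ fun d hd => ?_)
  rw [powersId_apply]
  congr 1
  rw [eq_iff_iff, Nat.dvd_prime_pow hq]
  constructor
  · rintro ⟨k, rfl⟩
    refine ⟨k, ?_, rfl⟩
    have := Fact.mk hq
    exact (padicValNat_dvd_iff_le n.ne_zero).1 (Nat.dvd_of_mem_divisors hd)
  · rintro ⟨k, _, rfl⟩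
    exact ⟨k, rfl⟩

/-! ### The conjugation action on full cycles -/

section FullCycle

/-- The translation `x ↦ 1 + x` of `ℤ/n`, as an `n`-cycle. -/
def translationCycle (n : ℕ+) : FullCycle (ZMod n) :=
  ⟨Equiv.addLeft 1, Set.bijOn_univ.2 (Equiv.bijective _), fun x _ y _ => ⟨(y - x).val, by
    rw [zpow_natCast, addLeft_pow_apply]; simp⟩⟩

instance (n : ℕ+) : Finite (FullCycle (ZMod n)) := Subtype.finite

/-- The conjugator is a ↦ τ^a(0), which labels each point by its number of τ-steps from 0. -/
lemma exists_smul_translationCycle (n : ℕ+) (τ : FullCycle (ZMod n)) :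
    ∃ g : Equiv.Perm (ZMod n), g • translationCycle n = τ := by
  have hτ : τ.1.IsCycleOn ((Finset.univ : Finset (ZMod n)) : Set (ZMod n)) := by
    rw [Finset.coe_univ]
    exact τ.2
  have hval : ∀ i j : ℕ, (τ.1 ^ i) 0 = (τ.1 ^ j) 0 ↔ (i : ZMod n) = j := fun i j => by
    rw [hτ.pow_apply_eq_pow_apply (Finset.mem_univ _), Finset.card_univ, ZMod.card,
      ZMod.natCast_eq_natCast_iff]
  have hinj : Function.Injective fun a : ZMod n => (τ.1 ^ a.val) 0 := fun a b hab => by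
    simpa using (hval _ _).1 hab
  let g : Equiv.Perm (ZMod n) := Equiv.ofBijective _ (Finite.injective_iff_bijective.1 hinj)
  refine ⟨g, Subtype.ext ?_⟩
  change g * Equiv.addLeft 1 * g⁻¹ = τ.1
  rw [mul_inv_eq_iff_eq_mul]
  ext x
  change (τ.1 ^ (1 + x).val) 0 = τ.1 ((τ.1 ^ x.val) 0)
  rw [← Equiv.Perm.mul_apply, ← pow_succ', hval]
  simp [add_comm]

/-- A permutation commuting with x ↦ 1 + x is determined by its value at 0. -/
lemma smul_translationCycle_eq_iff (n : ℕ+) (σ : Equiv.Perm (ZMod n)) :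
    σ • translationCycle n = translationCycle n ↔ ∃ a, Equiv.addLeft a = σ := by
  have h : σ • translationCycle n = translationCycle n ↔
      σ * Equiv.addLeft 1 = Equiv.addLeft 1 * σ := by
    rw [← mul_inv_eq_iff_eq_mul]
    exact Subtype.ext_iff
  rw [h]
  constructor
  · intro h
    refine ⟨σ 0, ?_⟩
    have key : ∀ k : ℕ, σ (k : ZMod n) = σ 0 + k := fun k => by
      induction k with
      | zero => simp
      | succ k ih =>
        have := congrArg (fun f : Equiv.Perm (ZMod n) => f (k : ZMod n)) h
        simp only [Equiv.Perm.mul_apply, Equiv.coe_addLeft] at this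
        push_cast
        rw [add_comm (k : ZMod n), this, ih]
        ring
    ext x
    simpa using (key x.val).symm
  · rintro ⟨a, rfl⟩
    ext x
    simp [add_left_comm]

lemma addLeft_injective' (n : ℕ+) :
    Function.Injective fun a : ZMod n => (Equiv.addLeft a : Equiv.Perm (ZMod n)) := fun a b h => by
  simpa using congrArg (fun f : Equiv.Perm (ZMod n) => f 0) h

open Classical in
lemma filter_smul_translationCycle (n : ℕ+) :
    (Finset.univ.filter fun σ : Equiv.Perm (ZMod n) =>
      σ • translationCycle n = translationCycle n) =
    Finset.univ.map ⟨fun a : ZMod n => Equiv.addLeft a, addLeft_injective' n⟩ := by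
  ext σ
  simp [smul_translationCycle_eq_iff]

lemma card_fullCycle (n : ℕ+) : Nat.card (FullCycle (ZMod n)) * n = (n : ℕ).factorial := by
  classical
  have h := Nat.card_congr (MulAction.orbitProdStabilizerEquivGroup (Equiv.Perm (ZMod n))
    (translationCycle n))
  have horb : MulAction.orbit (Equiv.Perm (ZMod n)) (translationCycle n) = Set.univ :=
    Set.eq_univ_of_forall fun τ => exists_smul_translationCycle n τ
  have hstab : Nat.card (MulAction.stabilizer (Equiv.Perm (ZMod n)) (translationCycle n)) = n := by
    rw [Nat.card_eq_fintype_card, Fintype.card_subtype]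
    simp_rw [MulAction.mem_stabilizer_iff]
    rw [filter_smul_translationCycle, Finset.card_map, Finset.card_univ, ZMod.card]
  rw [Nat.card_prod, horb, Nat.card_univ, hstab, Nat.card_perm, Nat.card_zmod] at h
  exact h

/-- The action is transitive with stabilizer C_n: after exchanging sums every cycle contributes
equally, and |class| · n = n!. The weights are Ramanujan sums at r = 0, which every d divides. -/
lemma frobChar_fullCycle (n : ℕ+) :
    frobChar (Representation.ofMulAction ℂ (Equiv.Perm (ZMod n)) (FullCycle (ZMod n))) =
      necklacePart (nondivisibleId 0 * (μ : ArithmeticFunction ℂ)) n := by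
  classical
  have : Fintype (FullCycle (ZMod n)) := Fintype.ofFinite _
  have htr : ∀ σ : Equiv.Perm (ZMod n), LinearMap.trace ℂ _
      (Representation.ofMulAction ℂ (Equiv.Perm (ZMod n)) (FullCycle (ZMod n)) σ) =
      ∑ τ : FullCycle (ZMod n), if σ • τ = τ then 1 else 0 := fun σ =>
    trace_eq_card_fixed _ _ fun τ => Representation.ofMulAction_single σ τ 1
  have hin : ∀ τ : FullCycle (ZMod n), ∑ σ : Equiv.Perm (ZMod n),
      (if σ • τ = τ then (1 : ℂ) else 0) • cyclePowerSum σ =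
      ∑ a : ZMod n, cyclePowerSum (Equiv.addLeft a : Equiv.Perm (ZMod n)) := by
    intro τ
    obtain ⟨g, rfl⟩ := exists_smul_translationCycle n τ
    have : ∑ a : ZMod n, cyclePowerSum (Equiv.addLeft a : Equiv.Perm (ZMod n)) =
        ∑ σ : Equiv.Perm (ZMod n),
          (if σ • translationCycle n = translationCycle n then (1 : ℂ) else 0) •
            cyclePowerSum σ := by
      simp_rw [ite_smul, one_smul, zero_smul]
      rw [← Finset.sum_filter, filter_smul_translationCycle, Finset.sum_map]
      rfl
    rw [this]
    symm
    refine Fintype.sum_equiv (MulAut.conj g).toEquiv _ _ fun σ => ?_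
    change _ = (if (g * σ * g⁻¹) • g • translationCycle n = _ then (1 : ℂ) else 0) •
      cyclePowerSum (g * σ * g⁻¹)
    rw [cyclePowerSum_conj, smul_smul, inv_mul_cancel_right, mul_smul]
    simp only [smul_left_cancel_iff]
  have hR : ∀ d ∈ (n : ℕ).divisors, ramanujanSum n 0 d =
      (nondivisibleId 0 * (μ : ArithmeticFunction ℂ)) d := by
    refine ramanujanSum_eq n 0 _ fun d hd => ?_
    rw [nondivisibleId_apply, if_neg, if_pos (dvd_zero _)]
    rw [zero_dvd_iff]
    exact (Nat.pos_of_mem_divisors hd).ne'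
  rw [← sum_smul_cyclePowerSum n 0 _ hR]
  change ((Fintype.card (ZMod n)).factorial : ℂ)⁻¹ • ∑ σ : Equiv.Perm (ZMod n),
    LinearMap.trace ℂ _ _ • cyclePowerSum σ = _
  simp_rw [htr, Finset.sum_smul]
  rw [Finset.sum_comm]
  simp_rw [hin]
  rw [Finset.sum_const, ← Nat.cast_smul_eq_nsmul ℂ, smul_smul, ZMod.card, ← card_fullCycle,
    Finset.card_univ, ← Nat.card_eq_fintype_card]
  have hpos : (Nat.card (FullCycle (ZMod n)) : ℂ) ≠ 0 := by
    have := card_fullCycle n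
    intro h0
    rw [Nat.cast_eq_zero] at h0
    rw [h0, zero_mul] at this
    exact Nat.factorial_ne_zero _ this.symm
  congr 1
  · push_cast
    have : ((n : ℕ) : ℂ) ≠ 0 := by exact_mod_cast n.ne_zero
    field_simp
  · simp

lemma conjPart_eq (n : ℕ+) :
    conjPart n = necklacePart (nondivisibleId 0 * (μ : ArithmeticFunction ℂ)) n := by
  rw [← frobChar_fullCycle]
  obtain ⟨k, rfl⟩ : ∃ k : ℕ, n = k.succPNat := ⟨n.natPred, by simp⟩
  -- `ZMod (k + 1)` unfolds to `Fin (k + 1)`; only the `Fintype` and `DecidableEq` instances need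
  -- reconciling.
  have key : ∀ (i : Fintype (Fin (k + 1))) (j : DecidableEq (Fin (k + 1))),
      conjPart k.succPNat = @frobChar _ i j _ _ _ (Representation.ofMulAction ℂ
        (Equiv.Perm (Fin (k + 1))) (FullCycle (Fin (k + 1)))) := fun i j => by
    rw [conjPart]
    congr!
  exact key _ _

end FullCycle

/-! ### Schur-positivity of characteristics -/

section SchurPositivity

lemma frobChar_eq_add_of_isCompl {α V : Type} [Fintype α] [DecidableEq α] [AddCommGroup V]
    [Module ℂ V] [FiniteDimensional ℂ V] {ρ : Representation ℂ (Equiv.Perm α) V}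
    {W₁ W₂ : Subrepresentation ρ} (h : IsCompl W₁.toSubmodule W₂.toSubmodule) :
    frobChar ρ = frobChar W₁.toRepresentation + frobChar W₂.toRepresentation := by
  have htr : ∀ σ, LinearMap.trace ℂ V (ρ σ) =
      LinearMap.trace ℂ _ (W₁.toRepresentation σ) +
        LinearMap.trace ℂ _ (W₂.toRepresentation σ) := by
    intro σ
    let N : Bool → Submodule ℂ V := fun b => bif b then W₁.toSubmodule else W₂.toSubmodule
    have hN : DirectSum.IsInternal N :=
      (DirectSum.isInternal_submodule_iff_isCompl N (i := true) (j := false) (by simp)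
        (by ext b; cases b <;> simp)).2 h
    have hm : ∀ b, Set.MapsTo (ρ σ) (N b) (N b) := fun b => by
      cases b
      · exact fun v hv => W₂.apply_mem_toSubmodule σ hv
      · exact fun v hv => W₁.apply_mem_toSubmodule σ hv
    rw [LinearMap.trace_eq_sum_trace_restrict hN hm, Fintype.sum_bool]
    rfl
  simp only [frobChar, htr, add_smul, Finset.sum_add_distrib, smul_add]

/-- Maschke's theorem and induction on dimension: a nonzero reducible representation splits into two
strictly smaller ones. -/
lemma frobChar_mem_closure_schurFunctions (n : ℕ) : ∀ (d : ℕ) (V : Type) [AddCommGroup V]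
    [Module ℂ V] [FiniteDimensional ℂ V] (ρ : Representation ℂ (Equiv.Perm (Fin n)) V),
    Module.finrank ℂ V = d → frobChar ρ ∈ AddSubmonoid.closure (schurFunctions n) := by
  intro d
  induction d using Nat.strong_induction_on with
  | _ d ih =>
  intro V _ _ _ ρ hd
  by_cases hV : Subsingleton V
  · have : frobChar ρ = 0 := by
      have htr : ∀ σ, LinearMap.trace ℂ V (ρ σ) = 0 := fun σ => by
        rw [Subsingleton.elim (ρ σ) 0, _root_.map_zero]
      simp [frobChar, htr]
    rw [this]
    exact zero_mem _
  by_cases hirr : ρ.IsIrreducible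
  · exact AddSubmonoid.subset_closure ⟨V, _, _, ‹_›, ρ, hirr, rfl⟩
  rw [not_subsingleton_iff_nontrivial] at hV
  have hnt : Nontrivial (Subrepresentation ρ) := by
    refine ⟨⊥, ⊤, fun h => ?_⟩
    exact bot_ne_top (congrArg Subrepresentation.toSubmodule h)
  obtain ⟨W, hW⟩ : ∃ W : Subrepresentation ρ, ¬ (W = ⊥ ∨ W = ⊤) := by
    by_contra hc
    push Not at hc
    exact hirr ⟨hc⟩
  have hss : ρ.IsSemisimpleRepresentation :=
    (Representation.isSemisimpleRepresentation_iff_isSemisimpleModule_asModule ρ).2 inferInstance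
  obtain ⟨W', hWW⟩ := exists_isCompl W
  have hcompl : IsCompl W.toSubmodule W'.toSubmodule := by
    rw [isCompl_iff, disjoint_iff, codisjoint_iff]
    exact ⟨congrArg Subrepresentation.toSubmodule hWW.inf_eq_bot,
      congrArg Subrepresentation.toSubmodule hWW.sup_eq_top⟩
  have hsum := Submodule.finrank_add_eq_of_isCompl hcompl
  have hW0 : W.toSubmodule ≠ ⊥ := fun h => hW (.inl
    (Subrepresentation.toSubmodule_injective h))
  have hW0' : W'.toSubmodule ≠ ⊥ := fun h => by
    refine hW (.inr (Subrepresentation.toSubmodule_injective ?_))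
    have := hcompl.sup_eq_top
    rwa [h, sup_bot_eq] at this
  have hpos := Nat.pos_of_ne_zero (mt Submodule.finrank_eq_zero.1 hW0)
  have hpos' := Nat.pos_of_ne_zero (mt Submodule.finrank_eq_zero.1 hW0')
  rw [frobChar_eq_add_of_isCompl hcompl]
  exact add_mem (ih _ (by omega) _ _ rfl) (ih _ (by omega) _ _ rfl)

end SchurPositivity

/-! ### The three series as necklace series -/

lemma Conj_eq : Conj = necklaceSeries (nondivisibleId 0 * (μ : ArithmeticFunction ℂ)) := by
  rw [Conj, funext conjPart_eq, (hasFormalSum_necklacePart _).formalSum_eq]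

lemma Lie_eq : Lie = necklaceSeries (μ : ArithmeticFunction ℂ) := by
  rw [Lie, funext liePart_eq, (hasFormalSum_necklacePart _).formalSum_eq]

lemma LieVariant_eq {q : ℕ} (hq : q.Prime) :
    LieVariant q = necklaceSeries (powersId q * (μ : ArithmeticFunction ℂ)) := by
  rw [LieVariant, funext (lieVariantPart_eq hq), (hasFormalSum_necklacePart _).formalSum_eq]

lemma schurPositive_Conj : SchurPositive Conj := by
  intro n
  rw [Conj_eq, homogeneousComponent_necklaceSeries]
  rcases Nat.eq_zero_or_pos n with rfl | hn
  · simp [necklacePart]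
  · lift n to ℕ+ using hn
    rw [← conjPart_eq]
    have : Finite (FullCycle (Fin n)) :=
      inferInstanceAs (Finite {τ : Equiv.Perm (Fin n) // τ.IsCycleOn Set.univ})
    have : FiniteDimensional ℂ ℂ[FullCycle (Fin n)] := inferInstance
    exact frobChar_mem_closure_schurFunctions n _ _
      (Representation.ofMulAction ℂ (Equiv.Perm (Fin n)) (FullCycle (Fin n))) rfl

lemma nondivisibleId_mul_powersId_mul {q : ℕ} (hq : 2 ≤ q) (f : ArithmeticFunction ℂ) :
    nondivisibleId q * (powersId q * f) = nondivisibleId 0 * f := by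
  rw [← mul_assoc, nondivisibleId_mul_powersId hq]

end SymPleth

end

theorem mainTheorem12 :
    -- the formal sums that define `Conj`, `Lie` and `Lie^{(q)}` make sense
    (SymPleth.HasFormalSum SymPleth.conjPart SymPleth.Conj ∧
      SymPleth.HasFormalSum SymPleth.liePart SymPleth.Lie ∧
      ∀ q : ℕ, q.Prime →
        SymPleth.HasFormalSum (SymPleth.lieVariantPart q) (SymPleth.LieVariant q)) ∧
    -- `Conj = ∑_{k ≥ 1} p_k[Lie]`, and the sum is Schur-positive
    (SymPleth.HasFormalSum (fun k : ℕ+ => SymPleth.powerPleth k SymPleth.Lie) SymPleth.Conj ∧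
      SymPleth.SchurPositive
        (SymPleth.formalSum fun k : ℕ+ => SymPleth.powerPleth k SymPleth.Lie)) ∧
    -- `Lie = ∑_{k ≥ 1} μ(k) p_k[Conj]`
    SymPleth.HasFormalSum
      (fun k : ℕ+ => ArithmeticFunction.moebius (k : ℕ) • SymPleth.powerPleth k SymPleth.Conj)
      SymPleth.Lie ∧
    -- `Conj = ∑_{k ≥ 1} p_{2k-1}[Lie^{(2)}]`, and the sum is Schur-positive
    (SymPleth.HasFormalSum
        (fun k : ℕ+ => SymPleth.powerPleth (2 * k - 1) (SymPleth.LieVariant 2)) SymPleth.Conj ∧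
      SymPleth.SchurPositive
        (SymPleth.formalSum fun k : ℕ+ =>
          SymPleth.powerPleth (2 * k - 1) (SymPleth.LieVariant 2))) ∧
    -- `Lie^{(2)} = ∑_{k ≥ 1} μ(2k-1) p_{2k-1}[Conj]`
    SymPleth.HasFormalSum
      (fun k : ℕ+ => ArithmeticFunction.moebius (2 * (k : ℕ) - 1) •
        SymPleth.powerPleth (2 * k - 1) SymPleth.Conj)
      (SymPleth.LieVariant 2) ∧
    -- for every prime `q`, `Conj = ∑_{q ∤ n} p_n[Lie^{(q)}]`, and the sum is Schur-positive
    (∀ q : ℕ, q.Prime →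
      SymPleth.HasFormalSum
        (fun n : {n : ℕ+ // ¬ q ∣ (n : ℕ)} => SymPleth.powerPleth n (SymPleth.LieVariant q))
        SymPleth.Conj ∧
      SymPleth.SchurPositive
        (SymPleth.formalSum fun n : {n : ℕ+ // ¬ q ∣ (n : ℕ)} =>
          SymPleth.powerPleth n (SymPleth.LieVariant q))) ∧
    -- for every integer `q ≥ 2`, `Conj = ∑_{q ∤ n} p_n[∑_{k ≥ 0} Lie[p_{q^k}]]`
    (∀ q : ℕ+, 2 ≤ q →
      ∃ G : SymPleth.Series,
        SymPleth.HasFormalSum (fun k : ℕ => SymPleth.powerPleth (q ^ k) SymPleth.Lie) G ∧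
        SymPleth.HasFormalSum
          (fun n : {n : ℕ+ // ¬ (q : ℕ) ∣ (n : ℕ)} => SymPleth.powerPleth n G)
          SymPleth.Conj) := by
  have hsum {ι : Type} {f : ι → SymPleth.Series} (h : SymPleth.HasFormalSum f SymPleth.Conj) :
      SymPleth.HasFormalSum f SymPleth.Conj ∧ SymPleth.SchurPositive (SymPleth.formalSum f) :=
    ⟨h, h.formalSum_eq ▸ SymPleth.schurPositive_Conj⟩
  have h2 : Nat.Prime 2 := Nat.prime_two
  refine ⟨⟨?_, ?_, fun q hq => ?_⟩, hsum ?_, ?_, hsum ?_, ?_, fun q hq => hsum ?_, fun q hq => ?_⟩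
  · rw [SymPleth.Conj_eq, funext SymPleth.conjPart_eq]
    exact SymPleth.hasFormalSum_necklacePart _
  · rw [SymPleth.Lie_eq, funext SymPleth.liePart_eq]
    exact SymPleth.hasFormalSum_necklacePart _
  · rw [SymPleth.LieVariant_eq hq, funext (SymPleth.lieVariantPart_eq hq)]
    exact SymPleth.hasFormalSum_necklacePart _
  · rw [SymPleth.Conj_eq, SymPleth.Lie_eq]
    exact SymPleth.hasFormalSum_powerPleth _
  · have h := SymPleth.hasFormalSum_moebius_smul_powerPleth
      (SymPleth.nondivisibleId 0 * (ArithmeticFunction.moebius : ArithmeticFunction ℂ))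
    -- At q = 0 the divisibility hypothesis says that a product vanishes only if a factor does.
    rw [← mul_assoc, SymPleth.nondivisibleMoebiusId_mul_nondivisibleId (by simp) (by simp),
      one_mul] at h
    rw [SymPleth.Conj_eq, SymPleth.Lie_eq]
    exact h
  · rw [SymPleth.Conj_eq, SymPleth.LieVariant_eq h2,
      ← SymPleth.nondivisibleId_mul_powersId_mul le_rfl]
    exact SymPleth.hasFormalSum_powerPleth_odd _
  · have h := SymPleth.hasFormalSum_moebius_smul_powerPleth_odd (SymPleth.nondivisibleId 2 *
      (SymPleth.powersId 2 * (ArithmeticFunction.moebius : ArithmeticFunction ℂ)))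
    rw [← mul_assoc (SymPleth.nondivisibleMoebiusId 2),
      SymPleth.nondivisibleMoebiusId_mul_nondivisibleId (by simp)
      fun _ _ => h2.dvd_mul.1, one_mul, SymPleth.nondivisibleId_mul_powersId_mul le_rfl] at h
    rw [SymPleth.Conj_eq, SymPleth.LieVariant_eq h2]
    exact h
  · rw [SymPleth.Conj_eq, SymPleth.LieVariant_eq hq,
      ← SymPleth.nondivisibleId_mul_powersId_mul hq.two_le]
    exact SymPleth.hasFormalSum_powerPleth_coprime q _
  · rw [SymPleth.Conj_eq, SymPleth.Lie_eq]
    -- The inner sum is the necklace series of `powersId q * μ`, for composite q as well.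
    refine ⟨_, SymPleth.hasFormalSum_powerPleth_powers hq _, ?_⟩
    rw [← SymPleth.nondivisibleId_mul_powersId_mul (q := q) (by exact_mod_cast hq)]
    exact SymPleth.hasFormalSum_powerPleth_coprime q _
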